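/- Let $Q_0=[0,1)$ with Lebesgue measure and let $\mathcal D(Q_0)$ be the collection of dyadic intervals $[j2^{-k},(j+1)2^{-k})$, $k\ge 0$, $0\le j<2^k$. For $Q\in\mathcal D(Q_0)$ let $\langle\cdot\rangle_Q$ denote the average over $Q$ of a scalar, vector or matrix function. A $d\times d$ matrix weight is a function $W$ on $Q_0$ with values in $\mathbb C^{d\times d}$ whose entries are integrable and for which $W(x)$ is positive semidefinite for almost every $x\in Q_0$. For a matrix weight $W$ and $f\in L^2(Q_0;\mathbb C^d)$ put $$M^Wf(x)=\sup_{Q\in\mathcal D(Q_0),\,x\in Q}\bigl\|W^{1/2}(x)\,\langle W\rangle_Q^{-1}\,\langle W^{1/2}f\rangle_Q\bigr\|_{\mathbb C^d}\in[0,\infty],$$ where, in case $\langle W\rangle_Q$ is singular, $\langle W\rangle_Q^{-1}$ denotes the inverse on the orthogonal complement of $\ker\langle W\rangle_Q$, extended by $0$ to $\ker\langle W\rangle_Q$. Theorem. For every $d$ there is a constant $C<\infty$, depending only on $d$, such that for every $d\times d$ matrix weight $W$ the operator $M^W$ is bounded from $L^2(Q_0;\mathbb C^d)$ to $L^2(Q_0;\mathbb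 C)$ with bound $C$: for every $f\in L^2(Q_0;\mathbb C^d)$ the function $M^Wf$ is finite almost everywhere, belongs to $L^2(Q_0;\mathbb C)$, and $$\|M^Wf\|_{L^2(Q_0;\mathbb C)}\le C\,\|f\|_{L^2(Q_0;\mathbb C^d)}.$$ -/

import Mathlib

open MeasureTheory
open scoped ENNReal NNReal MatrixOrder ComplexOrder

noncomputable section

namespace MatrixWeighted

/-- The dyadic interval `[j 2⁻ᵏ, (j+1) 2⁻ᵏ)`. The dyadic subintervals of `Q₀ = [0, 1)` are those
with `j < 2 ^ k`. -/
def dyadic (k j : ℕ) : Set ℝ :=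
  Set.Ico ((j : ℝ) / 2 ^ k) (((j : ℝ) + 1) / 2 ^ k)

/-- The collection `𝒟(Q₀)` of dyadic subintervals of `Q₀ = [0, 1)`. -/
def dyadicIntervals : Set (Set ℝ) :=
  {Q | ∃ k j : ℕ, j < 2 ^ k ∧ Q = dyadic k j}

/-- Lebesgue measure on `Q₀`. -/
def mu : Measure ℝ := volume.restrict (Set.Ico (0 : ℝ) 1)

/-- A `d × d` matrix weight on `Q₀`: entrywise integrable and positive semidefinite almost
everywhere. -/
structure IsWeight {d : ℕ} (W : ℝ → Matrix (Fin d) (Fin d) ℂ) : Prop where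
  integrable : ∀ i j, Integrable (fun x => W x i j) mu
  posSemidef : ∀ᵐ x ∂mu, (W x).PosSemidef

/-- The entrywise average `⟨W⟩_Q` of a matrix function. -/
def matrixAvg {d : ℕ} (W : ℝ → Matrix (Fin d) (Fin d) ℂ) (Q : Set ℝ) :
    Matrix (Fin d) (Fin d) ℂ :=
  Matrix.of fun i j => ⨍ x in Q, W x i j

/-- The inverse of a Hermitian matrix on the orthogonal complement of its kernel, extended by `0`
on the kernel (the functional calculus of `t ↦ t⁻¹`, where `0⁻¹ = 0`). -/
def hermInv {d : ℕ} (A : Matrix (Fin d) (Fin d) ℂ) : Matrix (Fin d) (Fin d) ℂ :=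
  cfc (fun t : ℝ => t⁻¹) A

/-- For invertible Hermitian matrices `hermInv` is the usual inverse. -/
theorem hermInv_eq_inv {d : ℕ} {A : Matrix (Fin d) (Fin d) ℂ} (hA : A.IsHermitian)
    (h : IsUnit A) : hermInv A = A⁻¹ := by
  obtain ⟨u, rfl⟩ := h
  rw [hermInv, cfc_inv_id (R := ℝ) u hA.isSelfAdjoint, Matrix.coe_units_inv]

/-- The average `⟨W^{1/2} f⟩_Q`. -/
def weightedAvg {d : ℕ} (W : ℝ → Matrix (Fin d) (Fin d) ℂ) (f : ℝ → EuclideanSpace ℂ (Fin d))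
    (Q : Set ℝ) : EuclideanSpace ℂ (Fin d) :=
  ⨍ x in Q, Matrix.toEuclideanLin (CFC.sqrt (W x)) (f x)

/-- The maximal function
`M^W f (x) = sup_{Q ∈ 𝒟(Q₀), x ∈ Q} ‖W^{1/2}(x) ⟨W⟩_Q⁻¹ ⟨W^{1/2} f⟩_Q‖`, with values in
`[0, ∞]`. -/
def maximal {d : ℕ} (W : ℝ → Matrix (Fin d) (Fin d) ℂ) (f : ℝ → EuclideanSpace ℂ (Fin d))
    (x : ℝ) : ℝ≥0∞ :=
  ⨆ Q ∈ {Q ∈ dyadicIntervals | x ∈ Q},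
    ‖Matrix.toEuclideanLin (CFC.sqrt (W x) * hermInv (matrixAvg W Q)) (weightedAvg W f Q)‖ₑ

end MatrixWeighted

end

open MeasureTheory
open scoped ENNReal NNReal MatrixOrder ComplexOrder

noncomputable section

namespace MatrixWeighted

open Matrix Filter Topology

variable {d : ℕ}

/-! The supremum is linearized. If `E k` are disjoint measurable sets on which generation `k`
attains the maximum among the first `N` generations, the square integral of the truncated maximal
function becomes `∑ ⟨α_Q g_Q, g_Q⟩`, with `α_Q = ∫_{Q ∩ E k} W` for `Q` of generation `k` and `g_Q =
⟨W⟩_Q⁻¹ ⟨W^{1/2} f⟩_Q`. Disjointness makes `α` a matrix Carleson sequence: `m_Q = ∑_{Q' ⊆ Q} α_{Q'}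
≤ w_Q = ∫_Q W`. What remains is a Carleson embedding with a constant depending only on `d`.

For fixed `s ≥ 0` the matrix `A_Q = w_Q + s m_Q` exceeds the sum of its values at the two children
of `Q` by exactly `s α_Q`. Since `⟨A⁻¹ v, v⟩` is a supremum over `e` of expressions linear in `(A,
v)`, this excess produces the gain `s ⟨α_Q A_Q⁻¹ v_Q, A_Q⁻¹ v_Q⟩` (`quad_inv_add_le`), where `v_Q =
∫_Q W^{1/2} f`. Telescoping down the tree bounds the total gain by `‖f‖²` (`sum_quad_perturbed_le`).

This controls `A_Q⁻¹ v_Q`, while `w_Q⁻¹ v_Q` is wanted; the inequality `A_Q ≤ (1 + s) w_Q` does not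
compare these vectors in the form of `α_Q`. Instead, `w⁻¹` is a combination of `(w + s m)⁻¹` for `s
= 1, …, d`, with coefficients bounded in terms of `d` (`exists_inv_eq_sum`): after simultaneous
diagonalization this is Lagrange interpolation of polynomials of degree less than `d`. Singular
`w_Q` are handled by adding a small multiple of the identity and passing to the limit. -/

/-! ### Quadratic forms of positive matrices and their inverses -/

/-- The real quadratic form of a matrix. -/
def quad (A : Matrix (Fin d) (Fin d) ℂ) (x : Fin d → ℂ) : ℝ :=
  (star x ⬝ᵥ A *ᵥ x).re

lemma quad_add (A B : Matrix (Fin d) (Fin d) ℂ) (x : Fin d → ℂ) :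
    quad (A + B) x = quad A x + quad B x := by
  simp [quad, add_mulVec]

lemma quad_smul (c : ℝ) (A : Matrix (Fin d) (Fin d) ℂ) (x : Fin d → ℂ) :
    quad (c • A) x = c * quad A x := by
  simp [quad, smul_mulVec]

lemma quad_nonneg {A : Matrix (Fin d) (Fin d) ℂ} (hA : A.PosSemidef) (x : Fin d → ℂ) :
    0 ≤ quad A x :=
  (Complex.le_def.mp (hA.dotProduct_mulVec_nonneg x)).1

lemma quad_conj (S A : Matrix (Fin d) (Fin d) ℂ) (x : Fin d → ℂ) :
    quad (Sᴴ * A * S) x = quad A (S *ᵥ x) := by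
  simp only [quad, star_mulVec, dotProduct_mulVec, vecMul_vecMul]

/-- A positive semidefinite form is the square of a norm. -/
lemma quad_eq_norm_sq {A : Matrix (Fin d) (Fin d) ℂ} (hA : A.PosSemidef) (x : Fin d → ℂ) :
    quad A x = ‖toEuclideanLin (CFC.sqrt A) (WithLp.toLp 2 x)‖ ^ 2 := by
  have hs : (CFC.sqrt A)ᴴ = CFC.sqrt A := (CFC.sqrt_nonneg A).posSemidef.1
  have h : A = (CFC.sqrt A)ᴴ * 1 * CFC.sqrt A := by
    rw [hs, mul_one, CFC.sqrt_mul_sqrt_self A hA.nonneg]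
  conv_lhs => rw [h, quad_conj]
  rw [EuclideanSpace.norm_sq_eq, quad, one_mulVec, dotProduct, Complex.re_sum]
  refine Finset.sum_congr rfl fun i _ => ?_
  rw [Pi.star_apply, Complex.star_def, ← Complex.normSq_eq_conj_mul_self, Complex.ofReal_re,
    Complex.normSq_eq_norm_sq]
  rfl

lemma quad_sum_le {A : Matrix (Fin d) (Fin d) ℂ} (hA : A.PosSemidef) {ι : Type*} (s : Finset ι)
    (c : ι → ℂ) (x : ι → Fin d → ℂ) :
    quad A (∑ i ∈ s, c i • x i) ≤ s.card * ∑ i ∈ s, ‖c i‖ ^ 2 * quad A (x i) := by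
  simp only [quad_eq_norm_sq hA]
  have h : toEuclideanLin (CFC.sqrt A) (WithLp.toLp 2 (∑ i ∈ s, c i • x i)) =
      ∑ i ∈ s, c i • toEuclideanLin (CFC.sqrt A) (WithLp.toLp 2 (x i)) := by
    rw [WithLp.toLp_sum, map_sum]
    exact Finset.sum_congr rfl fun i _ => by rw [WithLp.toLp_smul, map_smul]
  rw [h]
  calc _ ≤ (∑ i ∈ s, ‖c i • toEuclideanLin (CFC.sqrt A) (WithLp.toLp 2 (x i))‖) ^ 2 := by
        gcongr; exact norm_sum_le _ _
    _ ≤ s.card * ∑ i ∈ s, ‖c i • toEuclideanLin (CFC.sqrt A) (WithLp.toLp 2 (x i))‖ ^ 2 :=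
        sq_sum_le_card_mul_sum_sq
    _ = _ := by simp only [norm_smul, mul_pow]

/-- The variational lower bound for the form of an inverse. -/
lemma two_mul_re_sub_quad_le_quad_inv {A : Matrix (Fin d) (Fin d) ℂ} (hA : A.PosDef)
    (v e : Fin d → ℂ) : 2 * (star e ⬝ᵥ v).re - quad A e ≤ quad A⁻¹ v := by
  have hdet : IsUnit A.det := (isUnit_iff_isUnit_det A).mp hA.isUnit
  have h := quad_nonneg hA.posSemidef (A⁻¹ *ᵥ v - e)
  have hH : A⁻¹ᴴ = A⁻¹ := hA.inv.1
  have hv : A *ᵥ (A⁻¹ *ᵥ v) = v := by rw [mulVec_mulVec, mul_nonsing_inv _ hdet, one_mulVec]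
  have h1 : star (A⁻¹ *ᵥ v) ⬝ᵥ v = star v ⬝ᵥ A⁻¹ *ᵥ v := by
    rw [star_mulVec, hH, dotProduct_mulVec]
  have h2 : star (A⁻¹ *ᵥ v) ⬝ᵥ A *ᵥ e = star v ⬝ᵥ e := by
    rw [star_mulVec, hH, dotProduct_mulVec, vecMul_vecMul, nonsing_inv_mul _ hdet, vecMul_one]
  have h3 : (star v ⬝ᵥ e).re = (star e ⬝ᵥ v).re := by
    rw [← Complex.conj_re (star e ⬝ᵥ v), ← Complex.star_def, star_dotProduct]
  have h4 : quad A (A⁻¹ *ᵥ v - e) = quad A⁻¹ v - 2 * (star e ⬝ᵥ v).re + quad A e := by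
    simp only [quad, mulVec_sub, hv, star_sub, sub_dotProduct, dotProduct_sub, h1, h2,
      Complex.sub_re, h3]
    ring
  linarith

/-- The maximizer `e = A⁻¹ v` gives equality in the variational bound. -/
lemma quad_inv_eq {A : Matrix (Fin d) (Fin d) ℂ} (hA : A.PosDef) (v : Fin d → ℂ) :
    quad A⁻¹ v = 2 * (star (A⁻¹ *ᵥ v) ⬝ᵥ v).re - quad A (A⁻¹ *ᵥ v) := by
  have hdet : IsUnit A.det := (isUnit_iff_isUnit_det A).mp hA.isUnit
  have hH : A⁻¹ᴴ = A⁻¹ := hA.inv.1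
  have hv : A *ᵥ (A⁻¹ *ᵥ v) = v := by rw [mulVec_mulVec, mul_nonsing_inv _ hdet, one_mulVec]
  have h1 : star (A⁻¹ *ᵥ v) ⬝ᵥ v = star v ⬝ᵥ A⁻¹ *ᵥ v := by
    rw [star_mulVec, hH, dotProduct_mulVec]
  simp only [quad, hv, h1]
  ring

/-- Superadditivity of the form of the inverse, with the gain produced by an excess `α`. -/
lemma quad_inv_add_le {A B α : Matrix (Fin d) (Fin d) ℂ} (hA : A.PosDef) (hB : B.PosDef)
    (hα : α.PosSemidef) {s : ℝ} (hs : 0 ≤ s) (u v : Fin d → ℂ) :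
    quad (A + B + s • α)⁻¹ (u + v) + s * quad α ((A + B + s • α)⁻¹ *ᵥ (u + v)) ≤
      quad A⁻¹ u + quad B⁻¹ v := by
  have hAB : (A + B + s • α).PosDef := (hA.add hB).add_posSemidef (hα.smul hs)
  rw [quad_inv_eq hAB]
  -- The maximizer for the sum serves as a test vector for both summands.
  set e := (A + B + s • α)⁻¹ *ᵥ (u + v)
  have h1 := two_mul_re_sub_quad_le_quad_inv hA u e
  have h2 := two_mul_re_sub_quad_le_quad_inv hB v e
  rw [quad_add, quad_add, quad_smul, dotProduct_add, Complex.add_re]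
  linarith

/-! ### Recovering an inverse from perturbed inverses by interpolation -/

/-- Simultaneous diagonalization of a positive definite and a Hermitian matrix. -/
lemma exists_simultaneous_diagonal {w m : Matrix (Fin d) (Fin d) ℂ} (hw : w.PosDef)
    (hm : m.PosSemidef) (hmw : (w - m).PosSemidef) :
    ∃ (S : Matrix (Fin d) (Fin d) ℂ) (D : Fin d → ℝ), IsUnit S ∧ (∀ i, 0 ≤ D i) ∧ (∀ i, D i ≤ 1) ∧
      w = S * Sᴴ ∧ m = S * diagonal (fun i => (D i : ℂ)) * Sᴴ := by
  set R := CFC.sqrt w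
  have hRR : R * R = w := CFC.sqrt_mul_sqrt_self w hw.posSemidef.nonneg
  have hRH : Rᴴ = R := (CFC.sqrt_nonneg w).posSemidef.1
  have hRu : IsUnit R := by
    have h : IsUnit (R * R) := hRR ▸ hw.isUnit
    rw [isUnit_iff_isUnit_det] at h ⊢
    rw [det_mul] at h
    exact isUnit_of_mul_isUnit_left h
  have hRd : IsUnit R.det := (isUnit_iff_isUnit_det R).mp hRu
  have hRiH : (R⁻¹)ᴴ = R⁻¹ := by rw [conjTranspose_nonsing_inv, hRH]
  set T := R⁻¹ * m * R⁻¹ with hT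
  have hTp : T.PosSemidef := by
    have := hm.mul_mul_conjTranspose_same R⁻¹
    rwa [hRiH] at this
  have hRT : R * T * R = m := by
    rw [hT]
    simp only [mul_assoc]
    rw [nonsing_inv_mul _ hRd, mul_one, ← mul_assoc, mul_nonsing_inv _ hRd, one_mul]
  have hT1 : (1 - T).PosSemidef := by
    have := hmw.mul_mul_conjTranspose_same R⁻¹
    rw [hRiH, mul_sub, sub_mul, ← hRR, ← mul_assoc, nonsing_inv_mul _ hRd, one_mul,
      mul_nonsing_inv _ hRd] at this
    exact this
  set U : Matrix (Fin d) (Fin d) ℂ := ↑hTp.1.eigenvectorUnitary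
  have hUU : U * Uᴴ = 1 := Unitary.coe_mul_star_self hTp.1.eigenvectorUnitary
  have hUU' : Uᴴ * U = 1 := Unitary.coe_star_mul_self hTp.1.eigenvectorUnitary
  have hspec : T = U * diagonal (fun i => (hTp.1.eigenvalues i : ℂ)) * Uᴴ := by
    conv_lhs => rw [hTp.1.spectral_theorem]
    rfl
  refine ⟨R * U, hTp.1.eigenvalues, hRu.mul (.of_mul_eq_one _ hUU), hTp.eigenvalues_nonneg,
    fun i => ?_, ?_, ?_⟩
  -- Conjugated by `U`, the positive matrix `1 - T` is diagonal with entries `1 - D i`.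
  · have h := hT1.conjTranspose_mul_mul_same U
    have h2 : Uᴴ * (1 - T) * U = diagonal (fun i => ((1 - hTp.1.eigenvalues i : ℝ) : ℂ)) := by
      rw [mul_sub, sub_mul, mul_one, hUU']
      conv_lhs => rw [hspec]
      simp only [mul_assoc, hUU', mul_one]
      rw [← mul_assoc, hUU', one_mul, ← diagonal_one, diagonal_sub]
      simp
    rw [h2, posSemidef_diagonal_iff] at h
    have := h i
    rw [Complex.zero_le_real] at this
    linarith
  · rw [conjTranspose_mul, hRH, mul_assoc, ← mul_assoc U, hUU, one_mul, hRR]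
  · rw [conjTranspose_mul, hRH, ← hRT]
    conv_lhs => rw [hspec]
    simp only [mul_assoc]

/-- The nodes `1, …, d`. -/
def node (i : ℕ) : ℝ := i + 1

lemma node_pos (i : ℕ) : 0 < node i := by unfold node; positivity

lemma node_injective : Function.Injective node := fun i j h => by
  simpa [node] using h

/-- The value at `0` of the Lagrange basis polynomial at the nodes `1, …, d`. -/
def lagrangeCoeff (d i : ℕ) : ℝ :=
  (Lagrange.basis (Finset.range d) node i).eval 0

/-- The polynomial `∏_{k ≠ j} (1 + x D k)` has degree at most `d - 1` and value `1` at `0`, so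
interpolation at `d` nodes recovers that value. -/
lemma sum_lagrangeCoeff_mul_prod (D : Fin d → ℝ) (j : Fin d) :
    ∑ i ∈ Finset.range d, lagrangeCoeff d i * ∏ k ∈ Finset.univ.erase j, (1 + node i * D k) = 1 := by
  set p : Polynomial ℝ := ∏ k ∈ Finset.univ.erase j, (1 + Polynomial.X * Polynomial.C (D k))
  have hp : ∀ x : ℝ, p.eval x = ∏ k ∈ Finset.univ.erase j, (1 + x * D k) := fun x => by
    simp only [p, Polynomial.eval_prod, Polynomial.eval_add, Polynomial.eval_mul,
      Polynomial.eval_one, Polynomial.eval_X, Polynomial.eval_C]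
  have hdeg : p.degree < (Finset.range d).card := by
    have h1 : p.natDegree ≤ ∑ k ∈ Finset.univ.erase j, 1 :=
      (Polynomial.natDegree_prod_le _ _).trans <| Finset.sum_le_sum fun k _ => by
        compute_degree
    have h2 : p.natDegree ≤ d - 1 := by simpa using h1
    have := j.pos
    refine lt_of_le_of_lt Polynomial.degree_le_natDegree ?_
    rw [Finset.card_range]
    exact_mod_cast (by omega : p.natDegree < d)
  have h := congrArg (Polynomial.eval 0)
    (Lagrange.eq_interpolate (v := node) node_injective.injOn hdeg)
  rw [Lagrange.interpolate_apply, Polynomial.eval_finsetSum, hp] at h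
  simp only [zero_mul, add_zero, Finset.prod_const_one, Polynomial.eval_mul, Polynomial.eval_C,
    hp] at h
  exact (h.trans (Finset.sum_congr rfl fun i _ => mul_comm _ _)).symm

/-- The dimensional constant of the Carleson embedding. -/
def nodeConst (d : ℕ) : ℝ :=
  d * ∑ i ∈ Finset.range d, (lagrangeCoeff d i * (1 + node i) ^ d) ^ 2 / node i

/-- In coordinates where `w = 1` and `m` is diagonal, the identity reads `1 = ∑ c i / (1 + node i *
D a)` for every `a`. The bound on `c` uses only `0 ≤ m ≤ w`. -/
lemma exists_inv_eq_sum {w m : Matrix (Fin d) (Fin d) ℂ} (hw : w.PosDef)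
    (hm : m.PosSemidef) (hmw : (w - m).PosSemidef) :
    ∃ c : ℕ → ℂ, (∀ i, ‖c i‖ ≤ |lagrangeCoeff d i| * (1 + node i) ^ d) ∧
      w⁻¹ = ∑ i ∈ Finset.range d, c i • (w + node i • m)⁻¹ := by
  obtain ⟨S, D, hS, hD0, hD1, hwS, hmS⟩ := exists_simultaneous_diagonal hw hm hmw
  have hSd : IsUnit S.det := (isUnit_iff_isUnit_det S).mp hS
  have hSHd : IsUnit Sᴴ.det := by rw [det_conjTranspose]; exact hSd.star
  have hpos : ∀ i k, 0 < 1 + node i * D k := fun i k => by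
    have := mul_nonneg (node_pos i).le (hD0 k); linarith
  -- The full product makes `c i` independent of the diagonal position `a`: dividing by `1 + node i
  -- * D a` leaves the product over `k ≠ a`, to which interpolation applies.
  refine ⟨fun i => ((lagrangeCoeff d i * ∏ k, (1 + node i * D k) : ℝ) : ℂ), fun i => ?_, ?_⟩
  · rw [Complex.norm_real, Real.norm_eq_abs, abs_mul, Finset.abs_prod]
    gcongr
    calc _ ≤ ∏ k : Fin d, (1 + node i) := by
          refine Finset.prod_le_prod (fun _ _ => abs_nonneg _) fun k _ => ?_
          rw [abs_of_pos (hpos i k)]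
          have := mul_le_mul_of_nonneg_left (hD1 k) (node_pos i).le
          linarith
      _ = _ := by simp
  · have hinv : ∀ i, (w + node i • m)⁻¹ =
        Sᴴ⁻¹ * diagonal (fun k => (((1 + node i * D k)⁻¹ : ℝ) : ℂ)) * S⁻¹ := fun i => by
      have h1 : w + node i • m = S * diagonal (fun k => ((1 + node i * D k : ℝ) : ℂ)) * Sᴴ := by
        have : diagonal (fun k => ((1 + node i * D k : ℝ) : ℂ)) =
            1 + node i • diagonal (fun k => (D k : ℂ)) := by
          rw [← diagonal_one, ← diagonal_smul, diagonal_add]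
          congr 1; ext k; simp
        rw [this, mul_add, add_mul, mul_one, ← hwS, mul_smul_comm, smul_mul_assoc, ← hmS]
      refine inv_eq_right_inv ?_
      rw [h1]
      calc _ = S * (diagonal (fun k => ((1 + node i * D k : ℝ) : ℂ)) * (Sᴴ * Sᴴ⁻¹) *
            diagonal (fun k => (((1 + node i * D k)⁻¹ : ℝ) : ℂ))) * S⁻¹ := by
            simp only [mul_assoc]
        _ = 1 := by
            rw [mul_nonsing_inv _ hSHd, mul_one, diagonal_mul_diagonal]
            have : (fun k => ((1 + node i * D k : ℝ) : ℂ) * (((1 + node i * D k)⁻¹ : ℝ) : ℂ)) =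
                fun _ => 1 := by
              ext k
              rw [← Complex.ofReal_mul, mul_inv_cancel₀ (hpos i k).ne', Complex.ofReal_one]
            rw [this, diagonal_one, mul_one, mul_nonsing_inv _ hSd]
    have hw' : w⁻¹ = Sᴴ⁻¹ * 1 * S⁻¹ := by rw [hwS, Matrix.mul_inv_rev, mul_one]
    have hone : (1 : Matrix (Fin d) (Fin d) ℂ) = ∑ i ∈ Finset.range d,
        ((lagrangeCoeff d i * ∏ k, (1 + node i * D k) : ℝ) : ℂ) •
          diagonal (fun k => (((1 + node i * D k)⁻¹ : ℝ) : ℂ)) := by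
      simp_rw [← diagonal_smul]
      ext a b
      rw [Matrix.sum_apply]
      by_cases hab : a = b
      · subst hab
        simp only [one_apply_eq, diagonal_apply_eq, Pi.smul_apply, smul_eq_mul]
        refine (congrArg Complex.ofReal (sum_lagrangeCoeff_mul_prod D a)).symm.trans ?_
        rw [Complex.ofReal_sum]
        refine Finset.sum_congr rfl fun i _ => ?_
        rw [← Complex.ofReal_mul, ← Finset.mul_prod_erase Finset.univ _ (Finset.mem_univ a)]
        congr 1
        have := (hpos i a).ne'
        field_simp
      · simp [hab]
    rw [hw', hone, Finset.mul_sum, Finset.sum_mul]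
    refine Finset.sum_congr rfl fun i _ => ?_
    rw [hinv, mul_smul_comm, smul_mul_assoc]

lemma quad_inv_le_sum {w m α : Matrix (Fin d) (Fin d) ℂ} (hw : w.PosDef)
    (hm : m.PosSemidef) (hmw : (w - m).PosSemidef) (hα : α.PosSemidef) (v : Fin d → ℂ) :
    quad α (w⁻¹ *ᵥ v) ≤ d * ∑ i ∈ Finset.range d,
      (lagrangeCoeff d i * (1 + node i) ^ d) ^ 2 * quad α ((w + node i • m)⁻¹ *ᵥ v) := by
  obtain ⟨c, hc, hinv⟩ := exists_inv_eq_sum hw hm hmw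
  have : w⁻¹ *ᵥ v = ∑ i ∈ Finset.range d, c i • ((w + node i • m)⁻¹ *ᵥ v) := by
    rw [hinv, sum_mulVec]
    simp only [smul_mulVec]
  rw [this]
  refine (quad_sum_le hα _ _ _).trans ?_
  rw [Finset.card_range]
  refine mul_le_mul_of_nonneg_left (Finset.sum_le_sum fun i _ =>
    mul_le_mul_of_nonneg_right ?_ (quad_nonneg hα _)) (Nat.cast_nonneg d)
  refine (pow_le_pow_left₀ (norm_nonneg _) (hc i) 2).trans (le_of_eq ?_)
  rw [mul_pow, mul_pow, sq_abs]

/-! ### Measurability of the matrix square root -/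

section SquareRoot

open scoped Matrix.Norms.L2Operator

/-- Passing to the self-adjoint part extends the square root from positive semidefinite matrices to
a continuous function on all matrices, which can be composed with a measurable `W`. -/
lemma continuous_cfc_realSqrt_selfAdjointPart :
    Continuous fun A : Matrix (Fin d) (Fin d) ℂ =>
      cfc Real.sqrt ((2⁻¹ : ℝ) • (A + star A)) := by
  refine Continuous.cfc_of_mem_nhdsSet (s := Set.univ) Real.sqrt Filter.univ_mem (by fun_prop)
    (fun A => ?_) Real.continuous_sqrt.continuousOn
  exact (IsSelfAdjoint.all (2⁻¹ : ℝ)).smul (IsSelfAdjoint.add_star_self A)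

end SquareRoot

lemma sqrt_eq_cfc_selfAdjointPart {A : Matrix (Fin d) (Fin d) ℂ} (hA : A.PosSemidef) :
    CFC.sqrt A = cfc Real.sqrt ((2⁻¹ : ℝ) • (A + star A)) := by
  have h : (2⁻¹ : ℝ) • (A + star A) = A := by
    rw [star_eq_conjTranspose, hA.1.eq, ← two_smul ℝ A, smul_smul]; norm_num
  rw [h, CFC.sqrt_eq_real_sqrt A hA.nonneg, cfcₙ_eq_cfc]

lemma IsWeight.aestronglyMeasurable_sqrt {W : ℝ → Matrix (Fin d) (Fin d) ℂ} (hW : IsWeight W)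
    (i j : Fin d) : AEStronglyMeasurable (fun x => CFC.sqrt (W x) i j) mu := by
  have h1 : AEMeasurable (fun x (i j : Fin d) => W x i j) mu :=
    aemeasurable_pi_lambda _ fun i => aemeasurable_pi_lambda _ fun j =>
      (hW.integrable i j).1.aemeasurable
  have h2 : Continuous fun A : Fin d → Fin d → ℂ =>
      cfc Real.sqrt ((2⁻¹ : ℝ) • (Matrix.of A + star (Matrix.of A))) i j :=
    continuous_cfc_realSqrt_selfAdjointPart.matrix_elem i j
  have h3 : AEStronglyMeasurable (fun x => cfc Real.sqrt ((2⁻¹ : ℝ) • (W x + star (W x))) i j) mu :=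
    (h2.measurable.comp_aemeasurable h1).aestronglyMeasurable
  refine h3.congr ?_
  filter_upwards [hW.posSemidef] with x hx
  rw [sqrt_eq_cfc_selfAdjointPart hx]

/-! ### The generalized inverse and its regularization -/

section Inverse

lemma hermInv_smul {A : Matrix (Fin d) (Fin d) ℂ} (hA : A.IsHermitian) (c : ℝ) :
    hermInv (c • A) = c⁻¹ • hermInv A := by
  -- The spectrum is finite, so `t ↦ t⁻¹` is continuous on it even when it contains `0`.
  have hcont : ∀ (g : ℝ → ℝ) (B : Matrix (Fin d) (Fin d) ℂ), ContinuousOn g (spectrum ℝ B) :=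
    fun g B => (finite_real_spectrum (A := B)).continuousOn g
  have hcont' : ContinuousOn (fun t : ℝ => t⁻¹) ((c • ·) '' spectrum ℝ A) :=
    ((finite_real_spectrum (A := A)).image _).continuousOn _
  rw [hermInv, hermInv, ← cfc_comp_smul c _ A hcont' hA.isSelfAdjoint,
    ← cfc_smul c⁻¹ _ A (hcont _ _)]
  congr 1
  ext t
  simp [mul_comm]

lemma exists_unitary_diagonal {w : Matrix (Fin d) (Fin d) ℂ} (hw : w.PosSemidef) :
    ∃ (U : Matrix (Fin d) (Fin d) ℂ) (D : Fin d → ℝ), Uᴴ * U = 1 ∧ U * Uᴴ = 1 ∧ (∀ i, 0 ≤ D i) ∧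
      w = U * diagonal (fun i => (D i : ℂ)) * Uᴴ ∧
      hermInv w = U * diagonal (fun i => (((D i)⁻¹ : ℝ) : ℂ)) * Uᴴ := by
  refine ⟨hw.1.eigenvectorUnitary, hw.1.eigenvalues,
    Unitary.coe_star_mul_self hw.1.eigenvectorUnitary,
    Unitary.coe_mul_star_self hw.1.eigenvectorUnitary, hw.eigenvalues_nonneg, ?_, ?_⟩
  · conv_lhs => rw [hw.1.spectral_theorem]
    rfl
  · rw [hermInv, hw.1.cfc_eq]
    rfl

lemma mulVec_hermInv_mulVec {w : Matrix (Fin d) (Fin d) ℂ} (hw : w.PosSemidef) {v : Fin d → ℂ}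
    (hv : ∀ e, w *ᵥ e = 0 → star e ⬝ᵥ v = 0) : w *ᵥ (hermInv w *ᵥ v) = v := by
  obtain ⟨U, D, hU, hU', -, hwU, hinv⟩ := exists_unitary_diagonal hw
  -- `P` is the orthogonal projection onto `ker w`, as `1 - t * t⁻¹` is `1` at `t = 0` and `0`
  -- elsewhere.
  set P : Matrix (Fin d) (Fin d) ℂ :=
    U * diagonal (fun i => ((1 - D i * (D i)⁻¹ : ℝ) : ℂ)) * Uᴴ with hP
  have hwP : w * P = 0 := by
    have : w * P = U * (diagonal (fun i => (D i : ℂ)) * (Uᴴ * U) *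
        diagonal (fun i => ((1 - D i * (D i)⁻¹ : ℝ) : ℂ))) * Uᴴ := by
      rw [hP, hwU]; simp only [mul_assoc]
    rw [this, hU, mul_one, diagonal_mul_diagonal]
    have h0 : (fun i => (D i : ℂ) * ((1 - D i * (D i)⁻¹ : ℝ) : ℂ)) = 0 := by
      ext i
      rw [← Complex.ofReal_mul]
      by_cases h : D i = 0
      · simp [h]
      · simp [mul_inv_cancel₀ h]
    rw [h0]
    simp
  have hPw : P = 1 - w * hermInv w := by
    have : w * hermInv w = U * (diagonal (fun i => (D i : ℂ)) * (Uᴴ * U) *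
        diagonal (fun i => (((D i)⁻¹ : ℝ) : ℂ))) * Uᴴ := by
      rw [hinv, hwU]; simp only [mul_assoc]
    rw [this, hU, mul_one, diagonal_mul_diagonal, hP, ← hU']
    have h1 : diagonal (fun i => ((1 - D i * (D i)⁻¹ : ℝ) : ℂ)) =
        1 - diagonal (fun i => (D i : ℂ) * (((D i)⁻¹ : ℝ) : ℂ)) := by
      rw [← diagonal_one, diagonal_sub]
      congr 1; ext i; simp
    rw [h1, mul_sub, sub_mul, mul_one]
  have hPH : Pᴴ = P := by
    rw [hP, conjTranspose_mul, conjTranspose_mul, conjTranspose_conjTranspose,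
      diagonal_conjTranspose, mul_assoc]
    congr 3
    ext i
    simp
  have hPv : P *ᵥ v = 0 := by
    have h1 : ∀ x, star x ⬝ᵥ (P *ᵥ v) = 0 := fun x => by
      have := hv (P *ᵥ x) (by rw [mulVec_mulVec, hwP, zero_mulVec])
      rwa [star_mulVec, hPH, ← dotProduct_mulVec] at this
    exact dotProduct_star_self_eq_zero.mp (by simpa using h1 (P *ᵥ v))
  rw [hPw, sub_mulVec, one_mulVec, sub_eq_zero, ← mulVec_mulVec] at hPv
  exact hPv.symm

/-- Writing `v = w g` turns the blowing-up factors `(D i + ε)⁻¹` into the bounded `(D i + ε)⁻¹ * D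
i`, which vanish identically where `D i = 0`. -/
lemma tendsto_inv_add_smul_mulVec {w : Matrix (Fin d) (Fin d) ℂ} (hw : w.PosSemidef)
    {v : Fin d → ℂ} (hv : w *ᵥ (hermInv w *ᵥ v) = v) :
    Tendsto (fun ε : ℝ => (w + ε • (1 : Matrix (Fin d) (Fin d) ℂ))⁻¹ *ᵥ v) (𝓝[>] 0)
      (𝓝 (hermInv w *ᵥ v)) := by
  obtain ⟨U, D, hU, hU', hD, hwU, hinv⟩ := exists_unitary_diagonal hw
  set g := hermInv w *ᵥ v
  have hginv : hermInv w *ᵥ (w *ᵥ g) = g := by rw [hv]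
  have h1 : ∀ ε : ℝ, 0 < ε → (w + ε • (1 : Matrix (Fin d) (Fin d) ℂ))⁻¹ *ᵥ v =
      (U * diagonal (fun i => (((D i + ε)⁻¹ * D i : ℝ) : ℂ)) * Uᴴ) *ᵥ g := fun ε hε => by
    have hi : (w + ε • (1 : Matrix (Fin d) (Fin d) ℂ))⁻¹ =
        U * diagonal (fun i => (((D i + ε)⁻¹ : ℝ) : ℂ)) * Uᴴ := by
      have h2 : w + ε • (1 : Matrix (Fin d) (Fin d) ℂ) =
          U * diagonal (fun i => ((D i + ε : ℝ) : ℂ)) * Uᴴ := by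
        have : diagonal (fun i => ((D i + ε : ℝ) : ℂ)) =
            diagonal (fun i => (D i : ℂ)) + ε • (1 : Matrix (Fin d) (Fin d) ℂ) := by
          rw [← diagonal_one, ← diagonal_smul, diagonal_add]
          congr 1; ext i; simp
        rw [this, mul_add, add_mul, ← hwU, mul_smul_comm, smul_mul_assoc, mul_one, hU']
      refine inv_eq_right_inv ?_
      rw [h2]
      calc _ = U * (diagonal (fun i => ((D i + ε : ℝ) : ℂ)) * (Uᴴ * U) *
            diagonal (fun i => (((D i + ε)⁻¹ : ℝ) : ℂ))) * Uᴴ := by simp only [mul_assoc]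
        _ = 1 := by
            rw [hU, mul_one, diagonal_mul_diagonal]
            have : (fun i => ((D i + ε : ℝ) : ℂ) * (((D i + ε)⁻¹ : ℝ) : ℂ)) = fun _ => 1 := by
              ext i
              have : D i + ε ≠ 0 := by have := hD i; positivity
              rw [← Complex.ofReal_mul, mul_inv_cancel₀ this, Complex.ofReal_one]
            rw [this, diagonal_one, mul_one, hU']
    rw [← hv, mulVec_mulVec, hi, hwU]
    congr 1
    calc _ = U * (diagonal (fun i => (((D i + ε)⁻¹ : ℝ) : ℂ)) * (Uᴴ * U) *
          diagonal (fun i => (D i : ℂ))) * Uᴴ := by simp only [mul_assoc]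
      _ = _ := by
          rw [hU, mul_one, diagonal_mul_diagonal]
          simp only [Complex.ofReal_mul]
  have h2 : Tendsto (fun ε : ℝ => (U * diagonal (fun i => (((D i + ε)⁻¹ * D i : ℝ) : ℂ)) * Uᴴ) *ᵥ g)
      (𝓝[>] 0) (𝓝 ((U * diagonal (fun i => (((D i)⁻¹ * D i : ℝ) : ℂ)) * Uᴴ) *ᵥ g)) := by
    have hdiag : Tendsto (fun ε : ℝ => fun i => (((D i + ε)⁻¹ * D i : ℝ) : ℂ)) (𝓝[>] 0)
        (𝓝 fun i => (((D i)⁻¹ * D i : ℝ) : ℂ)) := by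
      refine tendsto_pi_nhds.mpr fun i => (Complex.continuous_ofReal.tendsto _).comp ?_
      by_cases h : D i = 0
      · simp [h]
      · have : ContinuousAt (fun ε : ℝ => (D i + ε)⁻¹ * D i) 0 := by
          have : D i + 0 ≠ 0 := by simpa using h
          fun_prop (disch := assumption)
        simpa using this.tendsto.mono_left nhdsWithin_le_nhds
    have hc : Continuous fun D : Fin d → ℂ => (U * diagonal D * Uᴴ) *ᵥ g := by fun_prop
    exact (hc.tendsto _).comp hdiag
  have h3 : (U * diagonal (fun i => (((D i)⁻¹ * D i : ℝ) : ℂ)) * Uᴴ) *ᵥ g = g := by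
    conv_rhs => rw [← hginv, mulVec_mulVec, hinv, hwU]
    congr 1
    symm
    calc _ = U * (diagonal (fun i => (((D i)⁻¹ : ℝ) : ℂ)) * (Uᴴ * U) *
          diagonal (fun i => (D i : ℂ))) * Uᴴ := by simp only [mul_assoc]
      _ = _ := by
          rw [hU, mul_one, diagonal_mul_diagonal]
          simp only [Complex.ofReal_mul]
  rw [h3] at h2
  refine h2.congr' ?_
  filter_upwards [self_mem_nhdsWithin] with ε hε
  exact (h1 ε hε).symm

end Inverse

/-! ### Integrals of the weight and of `W^{1/2} f` -/

/-- The entrywise integral of a matrix function over a set. -/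
def mass (W : ℝ → Matrix (Fin d) (Fin d) ℂ) (S : Set ℝ) : Matrix (Fin d) (Fin d) ℂ :=
  Matrix.of fun i j => ∫ x in S, W x i j

/-- The integral of `W^{1/2} f` over a set. -/
def weightedInt (W : ℝ → Matrix (Fin d) (Fin d) ℂ) (f : ℝ → EuclideanSpace ℂ (Fin d))
    (S : Set ℝ) : EuclideanSpace ℂ (Fin d) :=
  ∫ x in S, toEuclideanLin (CFC.sqrt (W x)) (f x)

lemma integrableOn_of_integrable_mu {E : Type*} [NormedAddCommGroup E] {g : ℝ → E}
    (hg : Integrable g mu) {S : Set ℝ} (hS : S ⊆ Set.Ico 0 1) : IntegrableOn g S :=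
  IntegrableOn.mono_set hg hS

lemma ae_restrict_of_ae_mu {p : ℝ → Prop} (h : ∀ᵐ x ∂mu, p x) {S : Set ℝ}
    (hS : S ⊆ Set.Ico 0 1) : ∀ᵐ x ∂volume.restrict S, p x :=
  ae_restrict_of_ae_restrict_of_subset hS h

lemma mass_union {W : ℝ → Matrix (Fin d) (Fin d) ℂ} (hW : IsWeight W) {S T : Set ℝ}
    (hST : Disjoint S T) (hT : MeasurableSet T) (hS1 : S ⊆ Set.Ico 0 1) (hT1 : T ⊆ Set.Ico 0 1) :
    mass W (S ∪ T) = mass W S + mass W T := by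
  ext i j
  exact setIntegral_union hST hT (integrableOn_of_integrable_mu (hW.integrable i j) hS1)
    (integrableOn_of_integrable_mu (hW.integrable i j) hT1)

lemma quad_eq_sum (A : Matrix (Fin d) (Fin d) ℂ) (e : Fin d → ℂ) :
    quad A e = ∑ i, ∑ j, (star (e i) * e j * A i j).re := by
  simp only [quad, dotProduct, mulVec, Finset.mul_sum, Complex.re_sum, Pi.star_apply]
  refine Finset.sum_congr rfl fun i _ => Finset.sum_congr rfl fun j _ => ?_
  congr 1
  ring

lemma IsWeight.integrable_quad {W : ℝ → Matrix (Fin d) (Fin d) ℂ} (hW : IsWeight W)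
    (e : Fin d → ℂ) : Integrable (fun x => quad (W x) e) mu := by
  simp only [quad_eq_sum]
  exact integrable_finsetSum _ fun i _ => integrable_finsetSum _ fun j _ =>
    ((hW.integrable i j).const_mul _).re

lemma quad_mass {W : ℝ → Matrix (Fin d) (Fin d) ℂ} (hW : IsWeight W) {S : Set ℝ}
    (hS : S ⊆ Set.Ico 0 1) (e : Fin d → ℂ) : quad (mass W S) e = ∫ x in S, quad (W x) e := by
  have hi : ∀ i j, Integrable (fun x => star (e i) * e j * W x i j) (volume.restrict S) :=
    fun i j => (integrableOn_of_integrable_mu (hW.integrable i j) hS).const_mul _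
  simp only [quad_eq_sum]
  have hre : ∀ i j, Integrable (fun x => (star (e i) * e j * W x i j).re) (volume.restrict S) :=
    fun i j => (hi i j).re
  rw [integral_finsetSum _ fun i _ => integrable_finsetSum _ fun j _ => hre i j]
  refine Finset.sum_congr rfl fun i _ => ?_
  rw [integral_finsetSum _ fun j _ => hre i j]
  refine Finset.sum_congr rfl fun j _ => ?_
  refine Eq.trans ?_ (integral_re (hi i j)).symm
  rw [integral_const_mul]
  rfl

lemma posSemidef_mass {W : ℝ → Matrix (Fin d) (Fin d) ℂ} (hW : IsWeight W) {S : Set ℝ}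
    (hS : S ⊆ Set.Ico 0 1) : (mass W S).PosSemidef := by
  have hH : (mass W S).IsHermitian := by
    ext i j
    simp only [conjTranspose_apply, mass, of_apply]
    refine (integral_conj (𝕜 := ℂ)).symm.trans (integral_congr_ae ?_)
    filter_upwards [ae_restrict_of_ae_mu hW.posSemidef hS] with x hx
    exact hx.1.apply i j
  refine .of_dotProduct_mulVec_nonneg hH fun e => ?_
  have him : (star e ⬝ᵥ mass W S *ᵥ e).im = 0 := hH.im_star_dotProduct_mulVec_self e
  refine Complex.le_def.mpr ⟨?_, him.symm⟩
  change 0 ≤ quad (mass W S) e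
  rw [quad_mass hW hS]
  refine integral_nonneg_of_ae ?_
  filter_upwards [ae_restrict_of_ae_mu hW.posSemidef hS] with x hx
  exact quad_nonneg hx e

lemma posSemidef_mass_sub {W : ℝ → Matrix (Fin d) (Fin d) ℂ} (hW : IsWeight W) {S T : Set ℝ}
    (hST : S ⊆ T) (hS : MeasurableSet S) (hT : MeasurableSet T) (hT1 : T ⊆ Set.Ico 0 1) :
    (mass W T - mass W S).PosSemidef := by
  have h := mass_union hW (disjoint_sdiff_self_right (x := S) (y := T)) (hT.diff hS) (hST.trans hT1)
    (Set.sdiff_subset.trans hT1)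
  rw [Set.union_sdiff_cancel hST] at h
  rw [h, add_sub_cancel_left]
  exact posSemidef_mass hW (Set.sdiff_subset.trans hT1)

lemma IsWeight.aestronglyMeasurable_sqrt_apply {W : ℝ → Matrix (Fin d) (Fin d) ℂ}
    (hW : IsWeight W) {f : ℝ → EuclideanSpace ℂ (Fin d)} (hf : AEStronglyMeasurable f mu) :
    AEStronglyMeasurable (fun x => toEuclideanLin (CFC.sqrt (W x)) (f x)) mu := by
  have h : AEStronglyMeasurable (fun x (i : Fin d) => ∑ j, CFC.sqrt (W x) i j * f x j) mu := by
    refine (aemeasurable_pi_lambda _ fun i => ?_).aestronglyMeasurable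
    refine Finset.aemeasurable_fun_sum _ fun j _ => ?_
    exact (hW.aestronglyMeasurable_sqrt i j).aemeasurable.mul
      ((EuclideanSpace.proj (𝕜 := ℂ) j).continuous.comp_aestronglyMeasurable hf).aemeasurable
  exact (PiLp.continuous_toLp 2 (fun _ : Fin d => ℂ)).comp_aestronglyMeasurable h

lemma norm_sq_sqrt_apply_le {A : Matrix (Fin d) (Fin d) ℂ} (hA : A.PosSemidef)
    (x : EuclideanSpace ℂ (Fin d)) :
    ‖toEuclideanLin (CFC.sqrt A) x‖ ^ 2 ≤ (d * A.trace.re) * ‖x‖ ^ 2 := by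
  have h1 := quad_sum_le hA Finset.univ (fun i => x i) (fun i => (Pi.single i 1 : Fin d → ℂ))
  have h2 : ∑ i, x i • (Pi.single i 1 : Fin d → ℂ) = x.ofLp := by
    ext j; simp [Pi.single_apply]
  have h3 : ∀ i, quad A (Pi.single i 1) = (A i i).re := fun i => by simp [quad]
  have h4 : ∀ i, 0 ≤ (A i i).re := fun i => by rw [← h3]; exact quad_nonneg hA _
  rw [h2, quad_eq_norm_sq hA, WithLp.toLp_ofLp] at h1
  refine h1.trans ?_
  rw [Finset.card_univ, Fintype.card_fin, mul_assoc]
  refine mul_le_mul_of_nonneg_left ?_ (Nat.cast_nonneg d)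
  rw [trace, Complex.re_sum, Finset.sum_mul]
  refine Finset.sum_le_sum fun i _ => ?_
  rw [h3, mul_comm]
  exact mul_le_mul_of_nonneg_left
    (pow_le_pow_left₀ (norm_nonneg _) (PiLp.norm_apply_le x i) 2) (h4 i)

lemma IsWeight.integrable_sqrt_apply {W : ℝ → Matrix (Fin d) (Fin d) ℂ}
    (hW : IsWeight W) {f : ℝ → EuclideanSpace ℂ (Fin d)} (hf : MemLp f 2 mu) :
    Integrable (fun x => toEuclideanLin (CFC.sqrt (W x)) (f x)) mu := by
  have htr : Integrable (fun x => (d * (W x).trace.re : ℝ)) mu := by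
    simp only [trace, Complex.re_sum]
    exact (integrable_finsetSum _ fun i _ => (hW.integrable i i).re).const_mul _
  have hf2 : Integrable (fun x => ‖f x‖ ^ 2) mu := hf.integrable_norm_pow (by norm_num)
  refine Integrable.mono' (htr.add hf2) (hW.aestronglyMeasurable_sqrt_apply hf.1) ?_
  filter_upwards [hW.posSemidef] with x hx
  have h := norm_sq_sqrt_apply_le hx (f x)
  have htr0 : 0 ≤ d * (W x).trace.re := mul_nonneg (Nat.cast_nonneg d)
    (Complex.le_def.mp hx.trace_nonneg).1
  refine abs_le_of_sq_le_sq' ?_ (add_nonneg htr0 (sq_nonneg _)) |>.2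
  refine h.trans ?_
  -- This is `a b ≤ (a + b)²` with `a = d tr W` and `b = ‖f‖²`.
  nlinarith [mul_nonneg htr0 (sq_nonneg ‖f x‖), sq_nonneg (d * (W x).trace.re), sq_nonneg (‖f x‖^2)]

lemma weightedInt_union {W : ℝ → Matrix (Fin d) (Fin d) ℂ} (hW : IsWeight W)
    {f : ℝ → EuclideanSpace ℂ (Fin d)} (hf : MemLp f 2 mu) {S T : Set ℝ}
    (hST : Disjoint S T) (hT : MeasurableSet T) (hS1 : S ⊆ Set.Ico 0 1) (hT1 : T ⊆ Set.Ico 0 1) :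
    weightedInt W f (S ∪ T) = weightedInt W f S + weightedInt W f T :=
  setIntegral_union hST hT (integrableOn_of_integrable_mu (hW.integrable_sqrt_apply hf) hS1)
    (integrableOn_of_integrable_mu (hW.integrable_sqrt_apply hf) hT1)

/-- Expand `‖A^{1/2} e - y‖² ≥ 0`. No inverse of `A` occurs, so singular matrices are allowed and
the bound can be integrated. -/
lemma two_mul_re_sqrt_apply_sub_quad_le {A : Matrix (Fin d) (Fin d) ℂ} (hA : A.PosSemidef)
    (e : Fin d → ℂ) (y : EuclideanSpace ℂ (Fin d)) :
    2 * (inner ℂ (WithLp.toLp 2 e) (toEuclideanLin (CFC.sqrt A) y)).re - quad A e ≤ ‖y‖ ^ 2 := by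
  have hs : (toEuclideanLin (CFC.sqrt A)).IsSymmetric :=
    isSymmetric_toEuclideanLin_iff.mpr (CFC.sqrt_nonneg A).posSemidef.1
  rw [quad_eq_norm_sq hA, ← hs]
  have h := norm_sub_sq (𝕜 := ℂ) (toEuclideanLin (CFC.sqrt A) (WithLp.toLp 2 e)) y
  have h' := sq_nonneg ‖toEuclideanLin (CFC.sqrt A) (WithLp.toLp 2 e) - y‖
  rw [h] at h'
  simp only [RCLike.re_to_complex] at h'
  linarith

lemma two_mul_re_weightedInt_sub_quad_le {W : ℝ → Matrix (Fin d) (Fin d) ℂ} (hW : IsWeight W)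
    {f : ℝ → EuclideanSpace ℂ (Fin d)} (hf : MemLp f 2 mu) {S : Set ℝ}
    (hS : S ⊆ Set.Ico 0 1) (e : Fin d → ℂ) :
    2 * (star e ⬝ᵥ (weightedInt W f S).ofLp).re - quad (mass W S) e ≤ ∫ x in S, ‖f x‖ ^ 2 := by
  have hi := integrableOn_of_integrable_mu (hW.integrable_sqrt_apply hf) hS
  have hf2 : Integrable (fun x => ‖f x‖ ^ 2) mu := hf.integrable_norm_pow (by norm_num)
  have h1 : (star e ⬝ᵥ (weightedInt W f S).ofLp).re =
      ∫ x in S, (inner ℂ (WithLp.toLp 2 e) (toEuclideanLin (CFC.sqrt (W x)) (f x))).re := by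
    have h2 : star e ⬝ᵥ (weightedInt W f S).ofLp = inner ℂ (WithLp.toLp 2 e) (weightedInt W f S) := by
      rw [EuclideanSpace.inner_eq_star_dotProduct, dotProduct_comm]
    rw [h2, weightedInt, ← integral_inner hi]
    exact (integral_re (hi.const_inner (𝕜 := ℂ) (WithLp.toLp 2 e))).symm
  have hi1 : IntegrableOn (fun x => 2 * (inner ℂ (WithLp.toLp 2 e)
      (toEuclideanLin (CFC.sqrt (W x)) (f x))).re) S := (hi.const_inner (𝕜 := ℂ) _).re.const_mul 2
  have hi2 := integrableOn_of_integrable_mu (hW.integrable_quad e) hS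
  rw [h1, quad_mass hW hS, ← integral_const_mul, ← integral_sub hi1 hi2]
  refine integral_mono_ae (hi1.sub hi2) (integrableOn_of_integrable_mu hf2 hS) ?_
  filter_upwards [ae_restrict_of_ae_mu hW.posSemidef hS] with x hx
  exact two_mul_re_sqrt_apply_sub_quad_le hx e (f x)

/-- The integral of `W^{1/2} f` lies in the range of the mass: on the kernel of the mass the
integrated inequality loses its quadratic term, and a linear form bounded above is zero. -/
lemma mass_mulVec_hermInv_weightedInt {W : ℝ → Matrix (Fin d) (Fin d) ℂ} (hW : IsWeight W)
    {f : ℝ → EuclideanSpace ℂ (Fin d)} (hf : MemLp f 2 mu) {S : Set ℝ} (hS : S ⊆ Set.Ico 0 1) :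
    mass W S *ᵥ (hermInv (mass W S) *ᵥ (weightedInt W f S).ofLp) = (weightedInt W f S).ofLp := by
  refine mulVec_hermInv_mulVec (posSemidef_mass hW hS) fun e he => ?_
  set z := star e ⬝ᵥ (weightedInt W f S).ofLp
  set F := ∫ x in S, ‖f x‖ ^ 2
  -- Testing with `(t z / 2) e` makes the linear term equal to `t |z|²`.
  have h : ∀ t : ℝ, t * Complex.normSq z ≤ F := fun t => by
    have h := two_mul_re_weightedInt_sub_quad_le hW hf hS ((t / 2 * z : ℂ) • e)
    have h0 : quad (mass W S) ((t / 2 * z : ℂ) • e) = 0 := by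
      rw [quad, mulVec_smul, he]; simp
    have h1 : star ((t / 2 * z : ℂ) • e) ⬝ᵥ (weightedInt W f S).ofLp =
        ((t / 2 * Complex.normSq z : ℝ) : ℂ) := by
      rw [star_smul, smul_dotProduct, smul_eq_mul]
      change star (t / 2 * z : ℂ) * z = _
      push_cast
      rw [Complex.normSq_eq_conj_mul_self, star_mul]
      simp
      ring
    rw [h0, h1, Complex.ofReal_re] at h
    linarith
  by_contra hz
  have hpos : 0 < Complex.normSq z := Complex.normSq_pos.mpr hz
  have := h ((F + 1) / Complex.normSq z)
  rw [div_mul_cancel₀ _ hpos.ne'] at this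
  linarith

/-- Insert the maximizer into the integrated inequality and discard the nonnegative form of `B`.
Here `B` stands for both the regularization and the Carleson perturbation. -/
lemma quad_inv_weightedInt_le {W : ℝ → Matrix (Fin d) (Fin d) ℂ} (hW : IsWeight W)
    {f : ℝ → EuclideanSpace ℂ (Fin d)} (hf : MemLp f 2 mu) {S : Set ℝ} (hS : S ⊆ Set.Ico 0 1)
    {B : Matrix (Fin d) (Fin d) ℂ} (hB : B.PosSemidef) (hA : (mass W S + B).PosDef) :
    quad (mass W S + B)⁻¹ (weightedInt W f S).ofLp ≤ ∫ x in S, ‖f x‖ ^ 2 := by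
  rw [quad_inv_eq hA, quad_add]
  have h := two_mul_re_weightedInt_sub_quad_le hW hf hS
    ((mass W S + B)⁻¹ *ᵥ (weightedInt W f S).ofLp)
  have := quad_nonneg hB ((mass W S + B)⁻¹ *ᵥ (weightedInt W f S).ofLp)
  linarith

/-! ### The dyadic tree -/

section Dyadic

lemma measurableSet_dyadic (k j : ℕ) : MeasurableSet (dyadic k j) := measurableSet_Ico

lemma dyadic_subset {k j : ℕ} (hj : j < 2 ^ k) : dyadic k j ⊆ Set.Ico 0 1 := by
  refine Set.Ico_subset_Ico (by positivity) ?_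
  rw [div_le_one (by positivity)]
  exact_mod_cast hj

lemma mem_dyadic_iff {k j : ℕ} {x : ℝ} (hx : 0 ≤ x) : x ∈ dyadic k j ↔ ⌊x * 2 ^ k⌋₊ = j := by
  rw [Nat.floor_eq_iff (by positivity), dyadic, Set.mem_Ico, div_le_iff₀ (by positivity),
    lt_div_iff₀ (by positivity)]

lemma dyadic_disjoint {k i j : ℕ} (hij : i ≠ j) : Disjoint (dyadic k i) (dyadic k j) := by
  refine Set.disjoint_left.mpr fun x hi hj => hij ?_
  have hx : 0 ≤ x := le_trans (by positivity) hi.1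
  rw [mem_dyadic_iff hx] at hi hj
  exact hi.symm.trans hj

lemma dyadic_eq_union (k j : ℕ) :
    dyadic k j = dyadic (k + 1) (2 * j) ∪ dyadic (k + 1) (2 * j + 1) := by
  have h1 : (j : ℝ) / 2 ^ k = ((2 * j : ℕ) : ℝ) / 2 ^ (k + 1) := by
    rw [pow_succ]; push_cast; field_simp
  have h2 : ((j : ℝ) + 1) / 2 ^ k = (((2 * j + 1 : ℕ) : ℝ) + 1) / 2 ^ (k + 1) := by
    rw [pow_succ]; push_cast; field_simp; ring
  have h3 : (((2 * j : ℕ) : ℝ) + 1) / 2 ^ (k + 1) = ((2 * j + 1 : ℕ) : ℝ) / 2 ^ (k + 1) := by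
    push_cast; ring
  rw [dyadic, dyadic, dyadic, h1, h2, h3, Set.Ico_union_Ico_eq_Ico]
  · gcongr; omega
  · gcongr; push_cast; linarith

lemma sum_range_two_pow_succ (g : ℕ → ℝ) (k : ℕ) :
    ∑ j ∈ Finset.range (2 ^ (k + 1)), g j = ∑ j ∈ Finset.range (2 ^ k), (g (2 * j) + g (2 * j + 1)) := by
  rw [pow_succ]
  -- The regrouping into pairs holds for any number of pairs, so the power of two is generalized.
  induction 2 ^ k with
  | zero => simp
  | succ n ih =>
    rw [Finset.sum_range_succ, ← ih, add_mul, one_mul, Finset.sum_range_succ, Finset.sum_range_succ,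
      mul_comm n 2]
    ring

lemma sum_setIntegral_dyadic {g : ℝ → ℝ} (hg : Integrable g mu) (k : ℕ) :
    ∑ j ∈ Finset.range (2 ^ k), ∫ x in dyadic k j, g x = ∫ x, g x ∂mu := by
  induction k with
  | zero => simp [dyadic, mu]
  | succ k ih =>
    rw [← ih, sum_range_two_pow_succ]
    refine Finset.sum_congr rfl fun j hj => ?_
    have hj' : dyadic k j ⊆ Set.Ico 0 1 := dyadic_subset (Finset.mem_range.mp hj)
    rw [dyadic_eq_union k j] at hj' ⊢
    exact (setIntegral_union (dyadic_disjoint (by omega)) (measurableSet_dyadic _ _)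
      (integrableOn_of_integrable_mu hg (Set.subset_union_left.trans hj'))
      (integrableOn_of_integrable_mu hg (Set.subset_union_right.trans hj'))).symm

end Dyadic

/-! ### Carleson embedding over disjoint stopping sets -/

/-- The stopping sets of generation at least `k`. -/
def tailSet (E : ℕ → Set ℝ) (k : ℕ) : Set ℝ := ⋃ i ≥ k, E i

lemma measurableSet_tailSet {E : ℕ → Set ℝ} (hE : ∀ k, MeasurableSet (E k)) (k : ℕ) :
    MeasurableSet (tailSet E k) :=
  .iUnion fun i => .iUnion fun _ => hE i

lemma tailSet_eq_union (E : ℕ → Set ℝ) (k : ℕ) : tailSet E k = E k ∪ tailSet E (k + 1) := by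
  ext x
  simp only [tailSet, Set.mem_iUnion, Set.mem_union, exists_prop]
  constructor
  · rintro ⟨i, hi, hx⟩
    rcases eq_or_lt_of_le hi with rfl | h
    · exact .inl hx
    · exact .inr ⟨i, h, hx⟩
  · rintro (hx | ⟨i, hi, hx⟩)
    · exact ⟨k, le_rfl, hx⟩
    · exact ⟨i, by omega, hx⟩

lemma disjoint_tailSet {E : ℕ → Set ℝ} (hE : Pairwise (Function.onFun Disjoint E)) (k : ℕ) :
    Disjoint (E k) (tailSet E (k + 1)) := by
  simp only [tailSet, Set.disjoint_iUnion_right]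
  exact fun i hi => hE (by omega)

section Carleson

variable {W : ℝ → Matrix (Fin d) (Fin d) ℂ} {f : ℝ → EuclideanSpace ℂ (Fin d)} {E : ℕ → Set ℝ}

/-- The regularized mass of a dyadic interval. -/
def regMass (W : ℝ → Matrix (Fin d) (Fin d) ℂ) (ε : ℝ) (k j : ℕ) : Matrix (Fin d) (Fin d) ℂ :=
  mass W (dyadic k j) + (ε / 2 ^ k) • (1 : Matrix (Fin d) (Fin d) ℂ)

/-- The mass carried in a dyadic interval by the stopping sets of the later generations. -/
def tailMass (W : ℝ → Matrix (Fin d) (Fin d) ℂ) (E : ℕ → Set ℝ) (k j : ℕ) :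
    Matrix (Fin d) (Fin d) ℂ :=
  mass W (dyadic k j ∩ tailSet E k)

lemma posDef_regMass (hW : IsWeight W) {ε : ℝ} (hε : 0 < ε) {k j : ℕ} (hj : j < 2 ^ k) :
    (regMass W ε k j).PosDef :=
  .posSemidef_add (posSemidef_mass hW (dyadic_subset hj)) (PosDef.one.smul (by positivity))

lemma posSemidef_tailMass (hW : IsWeight W) {k j : ℕ} (hj : j < 2 ^ k) :
    (tailMass W E k j).PosSemidef :=
  posSemidef_mass hW (Set.inter_subset_left.trans (dyadic_subset hj))

lemma posSemidef_regMass_sub_tailMass (hW : IsWeight W) (hE : ∀ k, MeasurableSet (E k)) {ε : ℝ}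
    (hε : 0 < ε) {k j : ℕ} (hj : j < 2 ^ k) : (regMass W ε k j - tailMass W E k j).PosSemidef := by
  have h := posSemidef_mass_sub hW (Set.inter_subset_left (s := dyadic k j) (t := tailSet E k))
    ((measurableSet_dyadic k j).inter (measurableSet_tailSet hE k)) (measurableSet_dyadic k j)
    (dyadic_subset hj)
  have := h.add (PosSemidef.one.smul (a := ε / 2 ^ k) (by positivity))
  rwa [← add_sub_right_comm] at this

/-- The regularization `ε / 2 ^ k` is proportional to the length of the interval, hence itself
additive over the two children. -/
lemma regMass_eq_add (hW : IsWeight W) (ε : ℝ) {k j : ℕ} (hj : j < 2 ^ k) :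
    regMass W ε k j = regMass W ε (k + 1) (2 * j) + regMass W ε (k + 1) (2 * j + 1) := by
  have h1 : 2 * j < 2 ^ (k + 1) := by rw [pow_succ]; omega
  have h2 : 2 * j + 1 < 2 ^ (k + 1) := by rw [pow_succ]; omega
  have h3 : ε / 2 ^ k = ε / 2 ^ (k + 1) + ε / 2 ^ (k + 1) := by rw [pow_succ]; field_simp; ring
  rw [regMass, regMass, regMass, dyadic_eq_union, mass_union hW (dyadic_disjoint (by omega))
    (measurableSet_dyadic _ _) (dyadic_subset h1) (dyadic_subset h2), h3, add_smul]
  abel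

/-- The excess over the children is the part of the tail carried by generation `k` itself; this is
the `α` that drives the telescoping. -/
lemma tailMass_eq_add (hW : IsWeight W) (hE : ∀ k, MeasurableSet (E k))
    (hd : Pairwise (Function.onFun Disjoint E)) {k j : ℕ} (hj : j < 2 ^ k) :
    tailMass W E k j = tailMass W E (k + 1) (2 * j) + tailMass W E (k + 1) (2 * j + 1) +
      mass W (dyadic k j ∩ E k) := by
  have h1 : 2 * j < 2 ^ (k + 1) := by rw [pow_succ]; omega
  have h2 : 2 * j + 1 < 2 ^ (k + 1) := by rw [pow_succ]; omega
  have hT := measurableSet_tailSet hE (k + 1)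
  rw [tailMass, tailSet_eq_union, Set.inter_union_distrib_left, mass_union hW
    ((disjoint_tailSet hd k).mono Set.inter_subset_right Set.inter_subset_right)
    ((measurableSet_dyadic k j).inter hT)
    (Set.inter_subset_left.trans (dyadic_subset hj))
    (Set.inter_subset_left.trans (dyadic_subset hj)), add_comm]
  congr 1
  rw [dyadic_eq_union, Set.union_inter_distrib_right, mass_union hW
    ((dyadic_disjoint (by omega)).mono Set.inter_subset_left Set.inter_subset_left)
    ((measurableSet_dyadic _ _).inter hT)
    (Set.inter_subset_left.trans (dyadic_subset h1))
    (Set.inter_subset_left.trans (dyadic_subset h2))]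
  rfl

lemma weightedInt_dyadic_eq_add (hW : IsWeight W) (hf : MemLp f 2 mu) {k j : ℕ} (hj : j < 2 ^ k) :
    weightedInt W f (dyadic k j) =
      weightedInt W f (dyadic (k + 1) (2 * j)) + weightedInt W f (dyadic (k + 1) (2 * j + 1)) := by
  have h1 : 2 * j < 2 ^ (k + 1) := by rw [pow_succ]; omega
  have h2 : 2 * j + 1 < 2 ^ (k + 1) := by rw [pow_succ]; omega
  rw [dyadic_eq_union, weightedInt_union hW hf (dyadic_disjoint (by omega))
    (measurableSet_dyadic _ _) (dyadic_subset h1) (dyadic_subset h2)]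

/-- The Carleson embedding for the perturbed weights: the Bellman function `v ↦ ⟨A⁻¹ v, v⟩`
telescopes along the dyadic tree. -/
lemma sum_quad_perturbed_le (hW : IsWeight W) (hf : MemLp f 2 mu)
    (hE : ∀ k, MeasurableSet (E k)) (hd : Pairwise (Function.onFun Disjoint E)) {ε s : ℝ}
    (hε : 0 < ε) (hs : 0 ≤ s) (N : ℕ) :
    s * ∑ k ∈ Finset.range N, ∑ j ∈ Finset.range (2 ^ k), quad (mass W (dyadic k j ∩ E k))
        ((regMass W ε k j + s • tailMass W E k j)⁻¹ *ᵥ (weightedInt W f (dyadic k j)).ofLp) ≤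
      ∫ x, ‖f x‖ ^ 2 ∂mu := by
  set A : ℕ → ℕ → Matrix (Fin d) (Fin d) ℂ := fun k j => regMass W ε k j + s • tailMass W E k j
  set v : ℕ → ℕ → Fin d → ℂ := fun k j => (weightedInt W f (dyadic k j)).ofLp
  set Φ : ℕ → ℝ := fun k => ∑ j ∈ Finset.range (2 ^ k), quad (A k j)⁻¹ (v k j)
  have hA : ∀ {k j}, j < 2 ^ k → (A k j).PosDef := fun hj =>
    (posDef_regMass hW hε hj).add_posSemidef ((posSemidef_tailMass hW hj).smul hs)
  have hstep : ∀ k, Φ k + s * ∑ j ∈ Finset.range (2 ^ k), quad (mass W (dyadic k j ∩ E k))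
      ((A k j)⁻¹ *ᵥ v k j) ≤ Φ (k + 1) := fun k => by
    simp only [Φ]
    rw [sum_range_two_pow_succ (fun j => quad (A (k + 1) j)⁻¹ (v (k + 1) j)), Finset.mul_sum,
      ← Finset.sum_add_distrib]
    refine Finset.sum_le_sum fun j hj => ?_
    have hj' := Finset.mem_range.mp hj
    have h1 : 2 * j < 2 ^ (k + 1) := by rw [pow_succ]; omega
    have h2 : 2 * j + 1 < 2 ^ (k + 1) := by rw [pow_succ]; omega
    have hAe : A k j = A (k + 1) (2 * j) + A (k + 1) (2 * j + 1) +
        s • mass W (dyadic k j ∩ E k) := by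
      simp only [A]
      rw [regMass_eq_add hW ε hj', tailMass_eq_add hW hE hd hj', smul_add, smul_add]
      abel
    have hve : v k j = v (k + 1) (2 * j) + v (k + 1) (2 * j + 1) := by
      simp only [v]
      rw [weightedInt_dyadic_eq_add hW hf hj', WithLp.ofLp_add]
    rw [hAe, hve]
    exact quad_inv_add_le (hA h1) (hA h2)
      (posSemidef_mass hW (Set.inter_subset_left.trans (dyadic_subset hj'))) hs _ _
  have hΦ0 : 0 ≤ Φ 0 := Finset.sum_nonneg fun j hj =>
    quad_nonneg (hA (Finset.mem_range.mp hj)).inv.posSemidef _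
  have htel : ∀ N, Φ 0 + s * ∑ k ∈ Finset.range N, ∑ j ∈ Finset.range (2 ^ k),
      quad (mass W (dyadic k j ∩ E k)) ((A k j)⁻¹ *ᵥ v k j) ≤ Φ N := fun N => by
    induction N with
    | zero => simp
    | succ N ih =>
      rw [Finset.sum_range_succ, mul_add]
      linarith [hstep N]
  have hlast : Φ N ≤ ∫ x, ‖f x‖ ^ 2 ∂mu := by
    rw [← sum_setIntegral_dyadic (hf.integrable_norm_pow (by norm_num)) N]
    refine Finset.sum_le_sum fun j hj => ?_
    have hj' := Finset.mem_range.mp hj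
    have hAe : A N j = mass W (dyadic N j) +
        ((ε / 2 ^ N) • (1 : Matrix (Fin d) (Fin d) ℂ) + s • tailMass W E N j) := by
      simp only [A, regMass, add_assoc]
    have hpd := hA hj'
    rw [hAe] at hpd ⊢
    exact quad_inv_weightedInt_le hW hf (dyadic_subset hj')
      ((PosSemidef.one.smul (by positivity)).add ((posSemidef_tailMass hW hj').smul hs)) hpd
  linarith [htel N]

lemma nodeConst_nonneg (d : ℕ) : 0 ≤ nodeConst d :=
  mul_nonneg (Nat.cast_nonneg d) (Finset.sum_nonneg fun i _ =>
    div_nonneg (sq_nonneg _) (node_pos i).le)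

/-- Interpolation reduces the unperturbed inverse to the `d` perturbed embeddings with `s = node i`,
each of which costs a factor `1 / node i`. -/
lemma sum_quad_regMass_le (hW : IsWeight W) (hf : MemLp f 2 mu)
    (hE : ∀ k, MeasurableSet (E k)) (hd : Pairwise (Function.onFun Disjoint E)) {ε : ℝ}
    (hε : 0 < ε) (N : ℕ) :
    ∑ k ∈ Finset.range N, ∑ j ∈ Finset.range (2 ^ k), quad (mass W (dyadic k j ∩ E k))
        ((regMass W ε k j)⁻¹ *ᵥ (weightedInt W f (dyadic k j)).ofLp) ≤
      nodeConst d * ∫ x, ‖f x‖ ^ 2 ∂mu := by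
  set c : ℕ → ℝ := fun i => (lagrangeCoeff d i * (1 + node i) ^ d) ^ 2
  set q : ℕ → ℕ → ℕ → ℝ := fun i k j => quad (mass W (dyadic k j ∩ E k))
    ((regMass W ε k j + node i • tailMass W E k j)⁻¹ *ᵥ (weightedInt W f (dyadic k j)).ofLp)
  calc _ ≤ ∑ k ∈ Finset.range N, ∑ j ∈ Finset.range (2 ^ k),
        (d * ∑ i ∈ Finset.range d, c i * q i k j : ℝ) := by
        refine Finset.sum_le_sum fun k _ => Finset.sum_le_sum fun j hj => ?_
        have hj' := Finset.mem_range.mp hj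
        exact quad_inv_le_sum (posDef_regMass hW hε hj') (posSemidef_tailMass hW hj')
          (posSemidef_regMass_sub_tailMass hW hE hε hj')
          (posSemidef_mass hW (Set.inter_subset_left.trans (dyadic_subset hj'))) _
    _ = d * ∑ i ∈ Finset.range d, c i / node i *
        (node i * ∑ k ∈ Finset.range N, ∑ j ∈ Finset.range (2 ^ k), q i k j) := by
        simp_rw [← Finset.mul_sum]
        congr 1
        simp_rw [Finset.sum_comm (t := Finset.range d), ← Finset.mul_sum]
        refine Finset.sum_congr rfl fun i _ => ?_
        have := (node_pos i).ne'
        field_simp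
    _ ≤ d * ∑ i ∈ Finset.range d, c i / node i * ∫ x, ‖f x‖ ^ 2 ∂mu := by
        refine mul_le_mul_of_nonneg_left (Finset.sum_le_sum fun i _ => ?_) (Nat.cast_nonneg d)
        exact mul_le_mul_of_nonneg_left
          (sum_quad_perturbed_le hW hf hE hd hε (node_pos i).le N)
          (div_nonneg (sq_nonneg _) (node_pos i).le)
    _ = _ := by rw [← Finset.sum_mul, ← mul_assoc]; rfl

lemma continuous_quad (A : Matrix (Fin d) (Fin d) ℂ) : Continuous (quad A) := by
  unfold quad
  fun_prop

/-- The vector `⟨W⟩_Q⁻¹ ⟨W^{1/2} f⟩_Q` for a dyadic interval `Q`. -/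
def coeffVec (W : ℝ → Matrix (Fin d) (Fin d) ℂ) (f : ℝ → EuclideanSpace ℂ (Fin d)) (k j : ℕ) :
    Fin d → ℂ :=
  hermInv (mass W (dyadic k j)) *ᵥ (weightedInt W f (dyadic k j)).ofLp

/-- The Carleson embedding for disjoint stopping sets. -/
lemma sum_quad_coeffVec_le (hW : IsWeight W) (hf : MemLp f 2 mu)
    (hE : ∀ k, MeasurableSet (E k)) (hd : Pairwise (Function.onFun Disjoint E)) (N : ℕ) :
    ∑ k ∈ Finset.range N, ∑ j ∈ Finset.range (2 ^ k),
        quad (mass W (dyadic k j ∩ E k)) (coeffVec W f k j) ≤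
      nodeConst d * ∫ x, ‖f x‖ ^ 2 ∂mu := by
  refine le_of_tendsto (f := fun ε : ℝ => ∑ k ∈ Finset.range N, ∑ j ∈ Finset.range (2 ^ k),
    quad (mass W (dyadic k j ∩ E k))
      ((regMass W ε k j)⁻¹ *ᵥ (weightedInt W f (dyadic k j)).ofLp)) (x := 𝓝[>] 0) ?_ ?_
  · refine tendsto_finsetSum _ fun k _ => tendsto_finsetSum _ fun j hj => ?_
    have hj' := dyadic_subset (Finset.mem_range.mp hj)
    refine ((continuous_quad _).tendsto _).comp ?_
    have h := tendsto_inv_add_smul_mulVec (posSemidef_mass hW hj')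
      (mass_mulVec_hermInv_weightedInt hW hf hj')
    have hε : Tendsto (fun ε : ℝ => ε / 2 ^ k) (𝓝[>] 0) (𝓝[>] 0) := by
      refine tendsto_nhdsWithin_iff.mpr ⟨?_, ?_⟩
      · have : Continuous fun ε : ℝ => ε / 2 ^ k := by fun_prop
        simpa using (this.tendsto 0).mono_left nhdsWithin_le_nhds
      · filter_upwards [self_mem_nhdsWithin] with ε hε
        have : (0 : ℝ) < ε := hε
        exact div_pos this (by positivity)
    exact h.comp hε
  · filter_upwards [self_mem_nhdsWithin] with ε hε
    exact sum_quad_regMass_le hW hf hE hd hε N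

end Carleson

/-! ### Linearizing a supremum -/

section Linearization

/-- A measurable choice of the first index at which a finite family is maximal. -/
lemma exists_measurable_argmax {α : Type*} [MeasurableSpace α] {g : ℕ → α → ℝ}
    (hg : ∀ k, Measurable (g k)) (N : ℕ) :
    ∃ E : ℕ → Set α, (∀ k, MeasurableSet (E k)) ∧ Pairwise (Function.onFun Disjoint E) ∧
      ∀ x, ∀ i < N, ∃ k < N, x ∈ E k ∧ g i x ≤ g k x := by
  -- Strict inequality against earlier indices breaks ties and makes the sets disjoint.
  refine ⟨fun k => {x | k < N ∧ (∀ i < N, g i x ≤ g k x) ∧ ∀ i < k, g i x < g k x},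
    fun k => ?_, fun k l hkl => ?_, fun x i hi => ?_⟩
  · have h1 : MeasurableSet {x | ∀ i < N, g i x ≤ g k x} := by
      simp only [Set.ofPred_forall]
      exact .iInter fun i => .iInter fun _ => measurableSet_le (hg i) (hg k)
    have h2 : MeasurableSet {x | ∀ i < k, g i x < g k x} := by
      simp only [Set.ofPred_forall]
      exact .iInter fun i => .iInter fun _ => measurableSet_lt (hg i) (hg k)
    exact (MeasurableSet.const _).inter (h1.inter h2)
  · refine Set.disjoint_left.mpr fun x hk hl => ?_
    rcases lt_or_gt_of_ne hkl with h | h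
    · exact (hl.2.2 k h).not_ge (hk.2.1 l hl.1)
    · exact (hk.2.2 l h).not_ge (hl.2.1 k hk.1)
  · classical
    have hex : ∃ k, k < N ∧ ∀ i < N, g i x ≤ g k x := by
      obtain ⟨k, hk, hmax⟩ := Finset.exists_max_image (Finset.range N) (fun k => g k x)
        ⟨i, Finset.mem_range.mpr hi⟩
      exact ⟨k, Finset.mem_range.mp hk, fun i hi => hmax i (Finset.mem_range.mpr hi)⟩
    obtain ⟨hk, hmax⟩ := Nat.find_spec hex
    refine ⟨Nat.find hex, hk, ⟨hk, hmax, fun i hi => ?_⟩, hmax i ‹_›⟩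
    by_contra hlt
    exact Nat.find_min hex hi
      ⟨hi.trans hk, fun l hl => (hmax l hl).trans (not_lt.mp hlt)⟩

/-- Monotone convergence reduces to the first `N` functions; their maximum is the one selected on
its set `E k`. The bound `B` must be uniform in the sets and in `N`. -/
lemma lintegral_iSup_ofReal_le {α : Type*} [MeasurableSpace α] {μ : Measure α} {g : ℕ → α → ℝ}
    (hg : ∀ k, Integrable (g k) μ) (hg0 : ∀ k, 0 ≤ᵐ[μ] g k) {B : ℝ}
    (hB : ∀ E : ℕ → Set α, (∀ k, MeasurableSet (E k)) → Pairwise (Function.onFun Disjoint E) →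
      ∀ N, ∑ k ∈ Finset.range N, ∫ x in E k, g k x ∂μ ≤ B) :
    ∫⁻ x, ⨆ k, ENNReal.ofReal (g k x) ∂μ ≤ ENNReal.ofReal B := by
  have hsup : ∀ x, ⨆ k, ENNReal.ofReal (g k x) =
      ⨆ N : ℕ, ⨆ k ∈ Set.Iio N, ENNReal.ofReal (g k x) := fun x => by
    refine le_antisymm (iSup_le fun k => ?_) (iSup_le fun N => iSup₂_le fun k _ =>
      le_iSup (fun k => ENNReal.ofReal (g k x)) k)
    exact le_iSup_of_le (k + 1) (le_iSup₂_of_le k (Nat.lt_succ_self k) le_rfl)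
  have hmeas : ∀ k, AEMeasurable (fun x => ENNReal.ofReal (g k x)) μ :=
    fun k => (hg k).1.aemeasurable.ennreal_ofReal
  simp only [hsup]
  rw [lintegral_iSup' (fun N => AEMeasurable.biSup (Set.Iio N) (Set.to_countable _) fun k _ => hmeas k)
    (ae_of_all _ fun x M N hMN => biSup_mono fun k hk =>
      Set.Iio_subset_Iio hMN hk)]
  refine iSup_le fun N => ?_
  obtain ⟨E, hE, hd, hmax⟩ := exists_measurable_argmax
    (fun k => (hg k).1.aemeasurable.measurable_mk) N
  have hmk : ∀ᵐ x ∂μ, ∀ k, g k x = (hg k).1.aemeasurable.mk (g k) x :=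
    ae_all_iff.mpr fun k => (hg k).1.aemeasurable.ae_eq_mk
  calc _ ≤ ∫⁻ x, ∑ k ∈ Finset.range N, (E k).indicator (fun x => ENNReal.ofReal (g k x)) x ∂μ := by
        refine lintegral_mono_ae ?_
        filter_upwards [hmk] with x hx
        refine iSup₂_le fun i hi => ?_
        obtain ⟨k, hk, hxk, hle⟩ := hmax x i hi
        rw [← hx, ← hx] at hle
        refine (ENNReal.ofReal_le_ofReal hle).trans ?_
        have h := Finset.single_le_sum
          (f := fun k => (E k).indicator (fun x => ENNReal.ofReal (g k x)) x)
          (fun _ _ => zero_le) (Finset.mem_range.mpr hk)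
        simpa [Set.indicator_of_mem hxk] using h
    _ = ∑ k ∈ Finset.range N, ENNReal.ofReal (∫ x in E k, g k x ∂μ) := by
        rw [lintegral_finsetSum' _ fun k _ => (hmeas k).indicator (hE k)]
        refine Finset.sum_congr rfl fun k _ => ?_
        rw [lintegral_indicator (hE k), ofReal_integral_eq_lintegral_ofReal (hg k).restrict
          (ae_restrict_of_ae (hg0 k))]
    _ = ENNReal.ofReal (∑ k ∈ Finset.range N, ∫ x in E k, g k x ∂μ) :=
        (ENNReal.ofReal_sum_of_nonneg fun k _ =>
          integral_nonneg_of_ae (ae_restrict_of_ae (hg0 k))).symm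
    _ ≤ _ := ENNReal.ofReal_le_ofReal (hB E hE hd N)

end Linearization

/-! ### The maximal function as a supremum over generations -/

variable {W : ℝ → Matrix (Fin d) (Fin d) ℂ} {f : ℝ → EuclideanSpace ℂ (Fin d)}

/-- The square of `‖W^{1/2}(x) ⟨W⟩_Q⁻¹ ⟨W^{1/2} f⟩_Q‖` for the dyadic interval `Q ∋ x` of
generation `k`. -/
def levelSq (W : ℝ → Matrix (Fin d) (Fin d) ℂ) (f : ℝ → EuclideanSpace ℂ (Fin d)) (k : ℕ)
    (x : ℝ) : ℝ :=
  ∑ j ∈ Finset.range (2 ^ k), (dyadic k j).indicator (fun x => quad (W x) (coeffVec W f k j)) x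

lemma levelSq_of_mem {k j : ℕ} (hj : j < 2 ^ k) {x : ℝ} (hx : x ∈ dyadic k j) :
    levelSq W f k x = quad (W x) (coeffVec W f k j) := by
  rw [levelSq, Finset.sum_eq_single_of_mem j (Finset.mem_range.mpr hj), Set.indicator_of_mem hx]
  intro i _ hij
  exact Set.indicator_of_notMem (fun hi => Set.disjoint_left.mp (dyadic_disjoint hij) hi hx) _

lemma integrable_levelSq (hW : IsWeight W) (k : ℕ) : Integrable (levelSq W f k) mu :=
  integrable_finsetSum _ fun j _ =>
    (hW.integrable_quad _).indicator (measurableSet_dyadic k j)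

lemma levelSq_nonneg {x : ℝ} (hx : (W x).PosSemidef) (k : ℕ) : 0 ≤ levelSq W f k x :=
  Finset.sum_nonneg fun _ _ => Set.indicator_apply_nonneg fun _ => quad_nonneg hx _

lemma setIntegral_levelSq (hW : IsWeight W) {S : Set ℝ} (hS : MeasurableSet S) (k : ℕ) :
    ∫ x in S, levelSq W f k x ∂mu =
      ∑ j ∈ Finset.range (2 ^ k), quad (mass W (dyadic k j ∩ S)) (coeffVec W f k j) := by
  rw [← integral_indicator hS, ← sum_setIntegral_dyadic ((integrable_levelSq hW k).indicator hS) k]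
  refine Finset.sum_congr rfl fun j hj => ?_
  have hj' := Finset.mem_range.mp hj
  rw [setIntegral_indicator hS, quad_mass hW (Set.inter_subset_left.trans (dyadic_subset hj'))]
  exact setIntegral_congr_fun ((measurableSet_dyadic k j).inter hS) fun x hx =>
    levelSq_of_mem hj' hx.1

/-- The factors `|Q|⁻¹` in the two averages cancel because `hermInv` is homogeneous of degree `-1`.
-/
lemma hermInv_matrixAvg_mulVec (hW : IsWeight W) {k j : ℕ} (hj : j < 2 ^ k) :
    hermInv (matrixAvg W (dyadic k j)) *ᵥ (weightedAvg W f (dyadic k j)).ofLp =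
      coeffVec W f k j := by
  set c : ℝ := (volume.real (dyadic k j))⁻¹
  have hc : c ≠ 0 := by
    refine inv_ne_zero ?_
    have h : (j : ℝ) / 2 ^ k < (j + 1) / 2 ^ k := by gcongr; linarith
    rw [dyadic, Real.volume_real_Ico_of_le h.le]
    exact (sub_pos.mpr h).ne'
  have h1 : matrixAvg W (dyadic k j) = c • mass W (dyadic k j) := by
    ext a b
    simp only [matrixAvg, of_apply, setAverage_eq]
    rfl
  have h2 : weightedAvg W f (dyadic k j) = c • weightedInt W f (dyadic k j) := by
    rw [weightedAvg, setAverage_eq]; rfl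
  rw [h1, h2, hermInv_smul (posSemidef_mass hW (dyadic_subset hj)).1, WithLp.ofLp_smul,
    mulVec_smul, smul_mulVec, smul_smul, mul_inv_cancel₀ hc, one_smul]
  rfl

lemma enorm_sq_eq_levelSq (hW : IsWeight W) {k j : ℕ} (hj : j < 2 ^ k) {x : ℝ}
    (hx : x ∈ dyadic k j) (hWx : (W x).PosSemidef) :
    ‖toEuclideanLin (CFC.sqrt (W x) * hermInv (matrixAvg W (dyadic k j)))
      (weightedAvg W f (dyadic k j))‖ₑ ^ 2 = ENNReal.ofReal (levelSq W f k x) := by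
  have h : toEuclideanLin (CFC.sqrt (W x) * hermInv (matrixAvg W (dyadic k j)))
      (weightedAvg W f (dyadic k j)) =
      toEuclideanLin (CFC.sqrt (W x)) (WithLp.toLp 2 (coeffVec W f k j)) := by
    rw [← hermInv_matrixAvg_mulVec hW hj]
    simp only [toLpLin_apply, mulVec_mulVec]
  rw [h, levelSq_of_mem hj hx, quad_eq_norm_sq hWx, ENNReal.ofReal_pow (norm_nonneg _),
    ofReal_norm]

/-- Each generation has exactly one interval containing `x`, so the supremum over intervals is a
countable one over generations. -/
lemma maximal_sq_eq (hW : IsWeight W) {x : ℝ} (hx : x ∈ Set.Ico (0 : ℝ) 1)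
    (hWx : (W x).PosSemidef) :
    maximal W f x ^ 2 = ⨆ k, ENNReal.ofReal (levelSq W f k x) := by
  refine le_antisymm ?_ (iSup_le fun k => ?_)
  · rw [maximal, ENNReal.iSup_pow]
    refine iSup_le fun Q => ?_
    by_cases hQ : Q ∈ {Q ∈ dyadicIntervals | x ∈ Q}
    · rw [iSup_pos hQ]
      obtain ⟨⟨k, j, hj, rfl⟩, hxQ⟩ := hQ
      rw [enorm_sq_eq_levelSq hW hj hxQ hWx]
      exact le_iSup (fun k => ENNReal.ofReal (levelSq W f k x)) k
    · rw [iSup_neg hQ]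
      simp
  · have hxk : x ∈ dyadic k ⌊x * 2 ^ k⌋₊ := (mem_dyadic_iff hx.1).mpr rfl
    have hj : ⌊x * 2 ^ k⌋₊ < 2 ^ k := by
      rw [Nat.floor_lt (mul_nonneg hx.1 (by positivity))]
      push_cast
      have : (0 : ℝ) < 2 ^ k := by positivity
      nlinarith [hx.2]
    rw [← enorm_sq_eq_levelSq hW hj hxk hWx]
    gcongr
    exact le_iSup₂ (f := fun Q (_ : Q ∈ {Q ∈ dyadicIntervals | x ∈ Q}) =>
      ‖toEuclideanLin (CFC.sqrt (W x) * hermInv (matrixAvg W Q)) (weightedAvg W f Q)‖ₑ)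
      (dyadic k ⌊x * 2 ^ k⌋₊) ⟨⟨k, _, hj, rfl⟩, hxk⟩

lemma ae_maximal_sq_eq (hW : IsWeight W) :
    ∀ᵐ x ∂mu, maximal W f x ^ 2 = ⨆ k, ENNReal.ofReal (levelSq W f k x) := by
  have hmem : ∀ᵐ x ∂mu, x ∈ Set.Ico (0 : ℝ) 1 := ae_restrict_mem measurableSet_Ico
  filter_upwards [hW.posSemidef, hmem] with x hx hx1
  exact maximal_sq_eq hW hx1 hx

lemma lintegral_maximal_sq_le (hW : IsWeight W) (hf : MemLp f 2 mu) :
    ∫⁻ x, maximal W f x ^ 2 ∂mu ≤ ENNReal.ofReal (nodeConst d * ∫ x, ‖f x‖ ^ 2 ∂mu) := by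
  rw [lintegral_congr_ae (ae_maximal_sq_eq hW)]
  refine lintegral_iSup_ofReal_le (fun k => integrable_levelSq hW k) (fun k => ?_)
    fun E hE hd N => ?_
  · filter_upwards [hW.posSemidef] with x hx
    exact levelSq_nonneg hx k
  · simp only [setIntegral_levelSq hW (hE _)]
    exact sum_quad_coeffVec_le hW hf hE hd N

lemma aemeasurable_maximal (hW : IsWeight W) : AEMeasurable (maximal W f) mu := by
  have h : AEMeasurable (fun x => (⨆ k, ENNReal.ofReal (levelSq W f k x)) ^ (1 / 2 : ℝ)) mu :=
    (AEMeasurable.iSup fun k => (integrable_levelSq hW k).1.aemeasurable.ennreal_ofReal).pow_const _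
  refine h.congr ?_
  filter_upwards [ae_maximal_sq_eq (f := f) hW] with x hx
  rw [← hx, ← ENNReal.rpow_natCast, ← ENNReal.rpow_mul]
  norm_num

lemma ofReal_integral_norm_sq (hf : MemLp f 2 mu) :
    ENNReal.ofReal (∫ x, ‖f x‖ ^ 2 ∂mu) = eLpNorm f 2 mu ^ 2 := by
  rw [ofReal_integral_eq_lintegral_ofReal (hf.integrable_norm_pow (by norm_num))
    (ae_of_all _ fun x => sq_nonneg _)]
  have h := eLpNorm_nnreal_pow_eq_lintegral (f := f) (μ := mu) (p := 2) (by norm_num)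
  simp only [NNReal.coe_ofNat, ENNReal.rpow_ofNat, ENNReal.coe_ofNat] at h
  rw [h]
  simp only [ENNReal.ofReal_pow (norm_nonneg _), ofReal_norm]

end MatrixWeighted

end

open MatrixWeighted in
theorem theoremt (d : ℕ) :
    ∃ C : ℝ≥0, ∀ W : ℝ → Matrix (Fin d) (Fin d) ℂ, MatrixWeighted.IsWeight W →
      ∀ f : ℝ → EuclideanSpace ℂ (Fin d), MemLp f 2 MatrixWeighted.mu →
        (∀ᵐ x ∂MatrixWeighted.mu, MatrixWeighted.maximal W f x < ∞) ∧
        MemLp (fun x => ((MatrixWeighted.maximal W f x).toReal : ℂ)) 2 MatrixWeighted.mu ∧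
        eLpNorm (fun x => ((MatrixWeighted.maximal W f x).toReal : ℂ)) 2 MatrixWeighted.mu
          ≤ C * eLpNorm f 2 MatrixWeighted.mu := by
  -- The Carleson embedding bounds squared norms by `nodeConst d`, hence the square root.
  refine ⟨(Real.sqrt (nodeConst d)).toNNReal, fun W hW f hf => ?_⟩
  have hmeas := aemeasurable_maximal (f := f) hW
  have hint := lintegral_maximal_sq_le hW hf
  have hfin : ∀ᵐ x ∂mu, maximal W f x < ∞ := by
    have h := ae_lt_top' (hmeas.pow_const 2) (hint.trans_lt ENNReal.ofReal_lt_top).ne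
    filter_upwards [h] with x hx
    simpa using hx
  have hle : eLpNorm (fun x => ((maximal W f x).toReal : ℂ)) 2 mu ≤
      (Real.sqrt (nodeConst d)).toNNReal * eLpNorm f 2 mu := by
    refine (ENNReal.pow_le_pow_left_iff two_ne_zero).mp ?_
    have h := eLpNorm_nnreal_pow_eq_lintegral (f := fun x => ((maximal W f x).toReal : ℂ))
      (μ := mu) (p := 2) (by norm_num)
    simp only [NNReal.coe_ofNat, ENNReal.rpow_ofNat, ENNReal.coe_ofNat] at h
    rw [h, mul_pow, ← ofReal_integral_norm_sq hf]
    have hc : ((Real.sqrt (nodeConst d)).toNNReal : ℝ≥0∞) ^ 2 = ENNReal.ofReal (nodeConst d) := by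
      change ENNReal.ofReal _ ^ 2 = _
      rw [← ENNReal.ofReal_pow (Real.sqrt_nonneg _), Real.sq_sqrt (nodeConst_nonneg d)]
    rw [hc, ← ENNReal.ofReal_mul (nodeConst_nonneg d)]
    refine le_trans (lintegral_mono fun x => ?_) hint
    gcongr
    rw [← ofReal_norm, Complex.norm_real, Real.norm_of_nonneg ENNReal.toReal_nonneg]
    -- Where the maximal function is infinite its `toReal` is `0`, so the inequality holds at every
    -- point.
    exact ENNReal.ofReal_toReal_le
  refine ⟨hfin, ⟨?_, hle.trans_lt (ENNReal.mul_lt_top ENNReal.coe_lt_top hf.2)⟩, hle⟩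
  exact (Complex.measurable_ofReal.comp_aemeasurable hmeas.ennreal_toReal).aestronglyMeasurable
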